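/- For $\theta\in\mathbb R^n$ write $\mathbb E_\theta$ for expectation when $X\sim N(\theta,I_n)$, and let $\|\cdot\|$ be the Euclidean norm. An estimator is a measurable map $\delta:\mathbb R^n\to\mathbb R^n$; its risk at $\theta$ is $\mathbb E_\theta\|\delta(X)-\theta\|^2\in[0,\infty]$. For $C>0$ and $\Theta\subseteq\mathbb R^n$, an estimator $\delta$ is called $C$-admissible over $\Theta$ if for every estimator $\tilde\delta$ there is $\theta\in\Theta$ with $$C\,\mathbb E_\theta\|\delta(X)-\theta\|^2\le \mathbb E_\theta\|\tilde\delta(X)-\theta\|^2 .$$ Theorem. There is a universal constant $C$ with $6.05\times10^{-6}\le C\le 1$ (independent of $n$, $\Theta$ and $f$) such that the following holds. Let $n\ge1$, let $\Theta\subseteq\mathbb R^n$ be closed and convex, and let $f:\Theta\to\mathbb R$ be convex and bounded below. Suppose that for Lebesgue-almost every $x\in\mathbb R^n$ the function $\alpha\mapsto\frac12\|x-\alpha\|^2+f(\alpha)$ attains its minimum over $\Theta$ (which is automatic, for every $x$, if $\Theta\neq\emptyset$ and $f$ is lower semicontinuous), so that the (necessarily unique) minimizer $$\widehat\theta(x;\Theta,f)=\operatorname*{argmin}_{\alpha\in\Theta}\Big(\tfrac12\|x-\alpha\|^2+f(\alpha)\Big)$$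 is defined for almost every $x$. Then the penalized least squares estimator $\widehat\theta(X;\Theta,f)$ is $C$-admissible over $\Theta$. -/

import Mathlib

open MeasureTheory ProbabilityTheory

namespace GaussianSequence

/-- The law `N(θ, Iₙ)` of the observation `X` in the Gaussian sequence model. -/
noncomputable def law {n : ℕ} (θ : EuclideanSpace ℝ (Fin n)) :
    Measure (EuclideanSpace ℝ (Fin n)) :=
  multivariateGaussian θ (1 : Matrix (Fin n) (Fin n) ℝ)

/-- The quadratic risk `E_θ ‖δ(X) - θ‖²` of an estimator `δ`, as an extended nonnegative real
(so an estimator of infinite risk has risk `∞`). -/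
noncomputable def risk {n : ℕ} (δ : EuclideanSpace ℝ (Fin n) → EuclideanSpace ℝ (Fin n))
    (θ : EuclideanSpace ℝ (Fin n)) : ENNReal :=
  ∫⁻ x, ENNReal.ofReal (‖δ x - θ‖ ^ 2) ∂(law θ)

/-- `δ` is `C`-admissible over `Θ`: for every estimator `δ'` there is a point `θ ∈ Θ` at which
`C` times the risk of `δ` is at most the risk of `δ'`. -/
def IsCAdmissible {n : ℕ} (C : ℝ) (Θ : Set (EuclideanSpace ℝ (Fin n)))
    (δ : EuclideanSpace ℝ (Fin n) → EuclideanSpace ℝ (Fin n)) : Prop :=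
  ∀ δ' : EuclideanSpace ℝ (Fin n) → EuclideanSpace ℝ (Fin n), Measurable δ' →
    ∃ θ ∈ Θ, ENNReal.ofReal C * risk δ θ ≤ risk δ' θ

/-- `δ` is the penalized least squares estimator with constraint set `Θ` and penalty `f`:
for almost every observation `x`, the point `δ x` minimizes `½‖x - α‖² + f α` over `α ∈ Θ`.
(For convex `f` the minimizer is unique when it exists.) -/
def IsPenalizedLSE {n : ℕ} (Θ : Set (EuclideanSpace ℝ (Fin n)))
    (f : EuclideanSpace ℝ (Fin n) → ℝ)
    (δ : EuclideanSpace ℝ (Fin n) → EuclideanSpace ℝ (Fin n)) : Prop :=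
  ∀ᵐ x ∂(volume : Measure (EuclideanSpace ℝ (Fin n))),
    δ x ∈ Θ ∧ IsMinOn (fun α => (1 / 2 : ℝ) * ‖x - α‖ ^ 2 + f α) Θ (δ x)

end GaussianSequence

/-! Almost everywhere the estimator equals `P`, a 1-Lipschitz map into Θ and a subgradient of the
finite convex function `u`, the conjugate of f + ½‖·‖² on Θ. Suppose some δ' has less than 1/2000 of
the risk of `P` at every point of Θ; a prior on Θ contradicts this. Centre the prior at a θ ∈ Θ
nearly maximizing E u(x + Z) − ‖x‖²/2 over all x, and take the law of θ + s(P(θ + Z) − θ), which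
lives in Θ by convexity. After rescaling, δ' becomes an accurate estimator D of p = P(θ + Z) from
noise plus s(p − θ). Write d for its value. The subgradient inequality and the choice of θ give [u(d
+ Z) − E u(d + Z')] − [u(θ + Z) − E u(θ + Z')] ≥ ½‖p − θ‖² − ½‖d − p‖² − η, with Z' a fresh copy in
the averages at fixed d. Accuracy would thus make d correlate with Z. Little correlation is
possible. Removing the signal by Cameron–Martin costs s²‖p − θ‖²/2, and then d is independent of Z.
For fixed d, property (τ), obtained from Prékopa–Leindler, bounds the exponential moment of the
fluctuation of u(d + Z) by its squared gradient, with no dimensional constant. Jensen turns this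
into `bayes_lower_bound`, which fails for small fixed s and l. -/

namespace GaussianSequence

open scoped ENNReal RealInnerProductSpace

/-! ### Brunn–Minkowski and Prékopa–Leindler on the line -/

/-- The one-dimensional Brunn–Minkowski inequality for compact sets. -/
lemma volume_add_volume_le_of_isCompact {K L N : Set ℝ} (hK : IsCompact K) (hL : IsCompact L)
    (hK0 : K.Nonempty) (hL0 : L.Nonempty) (h : ∀ x ∈ K, ∀ y ∈ L, x + y ∈ N) :
    volume K + volume L ≤ volume N := by
  obtain ⟨k, hkK, hk⟩ := hK.exists_isGreatest hK0
  obtain ⟨l, hlL, hl⟩ := hL.exists_isLeast hL0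
  -- The translates K + min L and L + max K both lie in N and meet at most at the point max K + min
  -- L.
  set A : Set ℝ := (fun w => w + -l) ⁻¹' K with hA
  set B : Set ℝ := (fun w => w + -k) ⁻¹' L with hB
  have hAv : volume A = volume K := measure_preimage_add_right _ _ _
  have hBv : volume B = volume L := measure_preimage_add_right _ _ _
  have hBm : MeasurableSet B := hL.measurableSet.preimage (by fun_prop)
  have hdisj : AEDisjoint volume A B := by
    refine measure_mono_null (t := {k + l}) ?_ (by simp)
    rintro w ⟨hwA, hwB⟩
    have h1 := hk hwA
    have h2 := hl hwB
    simp only [Set.mem_singleton_iff]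
    linarith
  rw [← hAv, ← hBv, ← measure_union₀ hBm.nullMeasurableSet hdisj]
  refine measure_mono ?_
  rintro w (hw | hw)
  · have := h _ hw _ hlL
    simpa using this
  · have := h _ hkK _ hw
    simpa using this

/-- The one-dimensional Brunn–Minkowski inequality for midpoints of measurable sets. -/
lemma volume_add_volume_le_two_mul {A B M : Set ℝ} (hA : MeasurableSet A) (hB : MeasurableSet B)
    (hA0 : A.Nonempty) (hB0 : B.Nonempty) (h : ∀ x ∈ A, ∀ y ∈ B, (x + y) / 2 ∈ M) :
    volume A + volume B ≤ 2 * volume M := by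
  set N : Set ℝ := (fun w => (2⁻¹ : ℝ) * w) ⁻¹' M with hN
  have hNv : volume N = 2 * volume M := by
    rw [hN, Real.volume_preimage_mul_left (by norm_num)]
    norm_num
  have hadd : ∀ x ∈ A, ∀ y ∈ B, x + y ∈ N := by
    intro x hx y hy
    have := h x hx y hy
    simp only [hN, Set.mem_preimage]
    convert this using 1
    ring
  rw [← hNv]
  obtain ⟨a, ha⟩ := hA0
  obtain ⟨b, hb⟩ := hB0
  have hsup : ∀ {C : Set ℝ}, MeasurableSet C →
      volume C = ⨆ K ∈ {K | K ⊆ C ∧ IsCompact K}, volume K := by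
    intro C hC
    rw [hC.measure_eq_iSup_isCompact]
    simp [iSup_and]
  rw [hsup hA, hsup hB]
  refine ENNReal.biSup_add_biSup_le ⟨∅, by simp⟩ ⟨∅, by simp⟩ ?_
  rintro K ⟨hKA, hK⟩ L ⟨hLB, hL⟩
  -- A compact approximant may be empty; inserting a point of the set restores nonemptiness.
  calc volume K + volume L ≤ volume (insert a K) + volume (insert b L) :=
        add_le_add (measure_mono (Set.subset_insert _ _)) (measure_mono (Set.subset_insert _ _))
    _ ≤ volume N := by
        refine volume_add_volume_le_of_isCompact (hK.insert a) (hL.insert b)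
          (Set.insert_nonempty _ _) (Set.insert_nonempty _ _) ?_
        intro x hx y hy
        exact hadd x (Set.insert_subset ha hKA hx) y (Set.insert_subset hb hLB hy)

/-- The additive form of the one-dimensional Prékopa–Leindler inequality, for functions whose
supremum is one. -/
lemma lintegral_add_lintegral_le_of_mul_le_sq {f g h : ℝ → ℝ} (hf : Measurable f)
    (hg : Measurable g) (hh : Measurable h) (hf0 : ∀ x, 0 ≤ f x) (hg0 : ∀ x, 0 ≤ g x)
    (hh0 : ∀ x, 0 ≤ h x) (hf1 : ∀ x, f x ≤ 1) (hg1 : ∀ x, g x ≤ 1)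
    (hfs : ∀ t < 1, ∃ x, t < f x) (hgs : ∀ t < 1, ∃ x, t < g x)
    (hfg : ∀ x y, f x * g y ≤ h ((x + y) / 2) ^ 2) :
    (∫⁻ x, ENNReal.ofReal (f x)) + ∫⁻ x, ENNReal.ofReal (g x)
      ≤ 2 * ∫⁻ x, ENNReal.ofReal (h x) := by
  rw [lintegral_eq_lintegral_meas_lt _ (ae_of_all _ hf0) hf.aemeasurable,
    lintegral_eq_lintegral_meas_lt _ (ae_of_all _ hg0) hg.aemeasurable,
    lintegral_eq_lintegral_meas_lt _ (ae_of_all _ hh0) hh.aemeasurable,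
    ← lintegral_const_mul' _ _ (by simp), ← lintegral_add_left']
  · refine setLIntegral_mono' measurableSet_Ioi fun t ht => ?_
    -- Layer by layer: below level 1 both level sets are nonempty, as Brunn–Minkowski requires; from
    -- level 1 on both are empty.
    rcases lt_or_ge t 1 with h1 | h1
    · refine volume_add_volume_le_two_mul (measurableSet_lt measurable_const hf)
        (measurableSet_lt measurable_const hg) (hfs t h1) (hgs t h1) ?_
      intro x hx y hy
      have hx' : t < f x := hx
      have hy' : t < g y := hy
      have ht' : 0 < t := ht
      refine lt_of_pow_lt_pow_left₀ 2 (hh0 _) (lt_of_lt_of_le ?_ (hfg x y))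
      nlinarith
    · have e1 : {a | t < f a} = ∅ := by
        ext x; simpa using (hf1 x).trans h1
      have e2 : {a | t < g a} = ∅ := by
        ext x; simpa using (hg1 x).trans h1
      simp [e1, e2]
  · have : Antitone fun t : ℝ => volume {a | t < f a} :=
      fun s t hst => measure_mono fun x hx => lt_of_le_of_lt hst hx
    exact this.measurable.aemeasurable

/-- The one-dimensional Prékopa–Leindler inequality with weights one half, for bounded functions. -/
lemma lintegral_mul_lintegral_le_sq {f g h : ℝ → ℝ} (hf : Measurable f)
    (hg : Measurable g) (hh : Measurable h) (hf0 : ∀ x, 0 ≤ f x) (hg0 : ∀ x, 0 ≤ g x)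
    (hh0 : ∀ x, 0 ≤ h x) (hfb : BddAbove (Set.range f)) (hgb : BddAbove (Set.range g))
    (hfg : ∀ x y, f x * g y ≤ h ((x + y) / 2) ^ 2) :
    (∫⁻ x, ENNReal.ofReal (f x)) * ∫⁻ x, ENNReal.ofReal (g x)
      ≤ (∫⁻ x, ENNReal.ofReal (h x)) ^ 2 := by
  set A := ⨆ x, f x with hAdef
  set B := ⨆ x, g x with hBdef
  have hfA : ∀ x, f x ≤ A := le_ciSup hfb
  have hgB : ∀ x, g x ≤ B := le_ciSup hgb
  have hA0 : 0 ≤ A := (hf0 0).trans (hfA 0)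
  have hB0 : 0 ≤ B := (hg0 0).trans (hgB 0)
  rcases hA0.eq_or_lt with hA | hA
  · have : ∀ x, f x = 0 := fun x => le_antisymm (hA ▸ hfA x) (hf0 x)
    simp [this]
  rcases hB0.eq_or_lt with hB | hB
  · have : ∀ x, g x = 0 := fun x => le_antisymm (hB ▸ hgB x) (hg0 x)
    simp [this]
  have hAB : 0 < √(A * B) := Real.sqrt_pos.2 (mul_pos hA hB)
  have hsq : √(A * B) ^ 2 = A * B := Real.sq_sqrt (mul_pos hA hB).le
  -- Normalize both suprema to 1; AM–GM then turns the additive bound into the product bound.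
  have key := lintegral_add_lintegral_le_of_mul_le_sq (f := fun x => A⁻¹ * f x)
    (g := fun x => B⁻¹ * g x) (h := fun x => (√(A * B))⁻¹ * h x)
    (by fun_prop) (by fun_prop) (by fun_prop)
    (fun x => mul_nonneg (inv_nonneg.2 hA0) (hf0 x))
    (fun x => mul_nonneg (inv_nonneg.2 hB0) (hg0 x))
    (fun x => mul_nonneg (inv_nonneg.2 hAB.le) (hh0 x))
    (fun x => by rw [inv_mul_le_iff₀ hA, mul_one]; exact hfA x)
    (fun x => by rw [inv_mul_le_iff₀ hB, mul_one]; exact hgB x)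
    (fun t ht => by
      obtain ⟨x, hx⟩ := exists_lt_of_lt_ciSup (show A * t < A by nlinarith)
      exact ⟨x, by rwa [lt_inv_mul_iff₀ hA]⟩)
    (fun t ht => by
      obtain ⟨x, hx⟩ := exists_lt_of_lt_ciSup (show B * t < B by nlinarith)
      exact ⟨x, by rwa [lt_inv_mul_iff₀ hB]⟩)
    (fun x y => by
      rw [mul_pow, inv_pow, hsq]
      calc A⁻¹ * f x * (B⁻¹ * g y) = (A * B)⁻¹ * (f x * g y) := by rw [mul_inv]; ring
        _ ≤ _ := by gcongr; exact hfg x y)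
  simp only [ENNReal.ofReal_mul (inv_nonneg.2 hA0), ENNReal.ofReal_mul (inv_nonneg.2 hB0),
    ENNReal.ofReal_mul (inv_nonneg.2 hAB.le)] at key
  rw [lintegral_const_mul' _ _ ENNReal.ofReal_ne_top,
    lintegral_const_mul' _ _ ENNReal.ofReal_ne_top,
    lintegral_const_mul' _ _ ENNReal.ofReal_ne_top] at key
  set I := ∫⁻ x, ENNReal.ofReal (f x)
  set J := ∫⁻ x, ENNReal.ofReal (g x)
  set H := ∫⁻ x, ENNReal.ofReal (h x)
  by_cases hH : H = ∞
  · simp [hH]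
  have hfin : ENNReal.ofReal A⁻¹ * I + ENNReal.ofReal B⁻¹ * J ≠ ∞ :=
    ne_top_of_le_ne_top (by finiteness) key
  have hI : I ≠ ∞ := by
    intro h
    rw [h, ENNReal.mul_top (by simpa using hA)] at hfin
    simp at hfin
  have hJ : J ≠ ∞ := by
    intro h
    rw [h, ENNReal.mul_top (by simpa using hB)] at hfin
    simp at hfin
  clear_value I J H
  lift I to NNReal using hI
  lift J to NNReal using hJ
  lift H to NNReal using hH
  have key' : A⁻¹ * (I : ℝ) + B⁻¹ * J ≤ 2 * ((√(A * B))⁻¹ * H) := by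
    have := ENNReal.toReal_mono (by finiteness) key
    rw [ENNReal.toReal_add (by finiteness) (by finiteness)] at this
    simpa [ENNReal.toReal_mul, hA0, hB0, inv_nonneg] using this
  have hreal : (I : ℝ) * J ≤ (H : ℝ) ^ 2 := by
    have h1 : 4 * ((A⁻¹ * (I : ℝ)) * (B⁻¹ * J)) ≤ (2 * ((√(A * B))⁻¹ * H)) ^ 2 := by
      refine le_trans ?_ (pow_le_pow_left₀ (by positivity) key' 2)
      nlinarith [sq_nonneg (A⁻¹ * (I : ℝ) - B⁻¹ * J)]
    have h2 : (2 * ((√(A * B))⁻¹ * (H : ℝ))) ^ 2 = 4 * ((A * B)⁻¹ * H ^ 2) := by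
      rw [mul_pow, mul_pow, inv_pow, hsq]; norm_num
    have h3 : 4 * ((A⁻¹ * (I : ℝ)) * (B⁻¹ * J)) = 4 * ((A * B)⁻¹ * (I * J)) := by
      rw [mul_inv]; ring
    rw [h2, h3] at h1
    exact le_of_mul_le_mul_left (by linarith) (inv_pos.2 (mul_pos hA hB))
  exact_mod_cast hreal

/-! ### Property (τ) and the exponential inequality -/

/-- Property (τ) of the standard Gaussian measure on the line, for the cost `|z - y|² / 4`. -/
lemma lintegral_mul_lintegral_gaussianReal_le_one {F G : ℝ → ℝ≥0∞} (hF : Measurable F)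
    (hG : Measurable G) (h : ∀ z y, F z * G y ≤ ENNReal.ofReal (Real.exp ((z - y) ^ 2 / 4))) :
    (∫⁻ z, F z ∂gaussianReal 0 1) * ∫⁻ y, G y ∂gaussianReal 0 1 ≤ 1 := by
  by_cases hF0 : ∀ z, F z = 0
  · simp [hF0]
  by_cases hG0 : ∀ z, G z = 0
  · simp [hG0]
  push Not at hF0 hG0
  obtain ⟨z₀, hz₀⟩ := hF0
  obtain ⟨y₀, hy₀⟩ := hG0
  have hFtop : ∀ z, F z ≠ ∞ := fun z hz => by
    have := h z y₀
    rw [hz, ENNReal.top_mul hy₀] at this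
    simp at this
  have hGtop : ∀ z, G z ≠ ∞ := fun z hz => by
    have := h z₀ z
    rw [hz, ENNReal.mul_top hz₀] at this
    simp at this
  set φ : ℝ → ℝ := gaussianPDFReal 0 1
  have hφ0 : ∀ x, 0 < φ x := fun x => gaussianPDFReal_pos 0 1 x one_ne_zero
  have hφm : Measurable φ := measurable_gaussianPDFReal 0 1
  have hreal : ∀ z y, (F z).toReal * (G y).toReal ≤ Real.exp ((z - y) ^ 2 / 4) := fun z y => by
    have := ENNReal.toReal_mono ENNReal.ofReal_ne_top (h z y)
    rwa [ENNReal.toReal_mul, ENNReal.toReal_ofReal (Real.exp_pos _).le] at this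
  -- The parallelogram identity: the cost is exactly the midpoint log-concavity defect of the
  -- Gaussian density.
  have hφmul : ∀ z y, Real.exp ((z - y) ^ 2 / 4) * (φ z * φ y) = φ ((z + y) / 2) ^ 2 := by
    intro z y
    simp only [φ, gaussianPDFReal_def]
    rw [mul_pow, sq (Real.exp _), ← Real.exp_add,
      show ∀ a b c d : ℝ, a * (b * c * (b * d)) = b ^ 2 * (a * c * d) by intros; ring,
      ← Real.exp_add, ← Real.exp_add]
    congr 2
    push_cast
    ring
  have hφle : ∀ x, φ x ≤ φ 0 := by
    intro x
    simp only [φ, gaussianPDFReal_def]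
    refine mul_le_mul_of_nonneg_left (Real.exp_le_exp.2 ?_) (by positivity)
    have := sq_nonneg x
    norm_num
    linarith
  have conv : ∀ {H : ℝ → ℝ≥0∞}, Measurable H → (∀ z, H z ≠ ∞) →
      ∫⁻ z, H z ∂gaussianReal 0 1 = ∫⁻ z, ENNReal.ofReal (φ z * (H z).toReal) := by
    intro H hH hHtop
    rw [gaussianReal_of_var_ne_zero 0 one_ne_zero,
      lintegral_withDensity_eq_lintegral_mul _ (measurable_gaussianPDF 0 1) hH]
    refine lintegral_congr fun z => ?_
    simp [gaussianPDF, ENNReal.ofReal_mul (hφ0 z).le, hHtop z, φ]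
  have hbound : ∀ {H : ℝ → ℝ≥0∞} {c w : ℝ}, 0 < c →
      (∀ z, (H z).toReal * c ≤ Real.exp ((z - w) ^ 2 / 4)) →
      BddAbove (Set.range fun z => φ z * (H z).toReal) := by
    intro H c w hc hH
    refine ⟨φ 0 ^ 2 / (c * φ w), ?_⟩
    rintro _ ⟨z, rfl⟩
    have h0 := hφ0 w
    rw [le_div_iff₀ (by positivity)]
    calc φ z * (H z).toReal * (c * φ w) = ((H z).toReal * c) * (φ z * φ w) := by ring
      _ ≤ Real.exp ((z - w) ^ 2 / 4) * (φ z * φ w) := by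
          gcongr
          · exact mul_nonneg (hφ0 z).le h0.le
          · exact hH z
      _ ≤ φ 0 ^ 2 := by
          rw [hφmul]
          exact pow_le_pow_left₀ (hφ0 _).le (hφle _) 2
  have hone : ∫⁻ x, ENNReal.ofReal (φ x) = 1 := lintegral_gaussianPDFReal_eq_one 0 one_ne_zero
  rw [conv hF hFtop, conv hG hGtop]
  refine (lintegral_mul_lintegral_le_sq (h := φ) (by fun_prop) (by fun_prop) hφm
    (fun x => mul_nonneg (hφ0 x).le ENNReal.toReal_nonneg)
    (fun x => mul_nonneg (hφ0 x).le ENNReal.toReal_nonneg) (fun x => (hφ0 x).le)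
    (hbound (w := y₀) (ENNReal.toReal_pos hy₀ (hGtop _)) fun z => hreal z y₀)
    (hbound (w := z₀) (ENNReal.toReal_pos hz₀ (hFtop _)) fun z => ?_) fun x y => ?_).trans ?_
  · rw [mul_comm]
    refine (hreal z₀ z).trans_eq ?_
    congr 2
    ring
  · rw [← hφmul]
    calc φ x * (F x).toReal * (φ y * (G y).toReal)
        = ((F x).toReal * (G y).toReal) * (φ x * φ y) := by ring
      _ ≤ _ := by
          gcongr
          · exact mul_nonneg (hφ0 x).le (hφ0 y).le
          · exact hreal x y
  · simp [hone]

/-- Property (τ) of the standard Gaussian measure on `Fin n → ℝ`, for the cost `|z - y|² / 4`. -/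
lemma lintegral_mul_lintegral_pi_gaussianReal_le_one {n : ℕ} {F G : (Fin n → ℝ) → ℝ≥0∞}
    (hF : Measurable F) (hG : Measurable G)
    (h : ∀ z y, F z * G y ≤ ENNReal.ofReal (Real.exp ((∑ i, (z i - y i) ^ 2) / 4))) :
    (∫⁻ z, F z ∂Measure.pi (fun _ => gaussianReal 0 1)) *
      ∫⁻ y, G y ∂Measure.pi (fun _ => gaussianReal 0 1) ≤ 1 := by
  induction n with
  | zero =>
    simp only [Measure.pi_of_empty (fun _ : Fin 0 => gaussianReal 0 1) 0]
    simpa [lintegral_dirac' _ hF, lintegral_dirac' _ hG] using h 0 0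
  | succ n ih =>
    have hmp := (measurePreserving_piFinSuccAbove
      (fun _ : Fin (n + 1) => gaussianReal 0 1) 0).symm
    have split : ∀ {H : (Fin (n + 1) → ℝ) → ℝ≥0∞}, Measurable H →
        ∫⁻ z, H z ∂Measure.pi (fun _ => gaussianReal 0 1) =
          ∫⁻ a, ∫⁻ z, H (Fin.cons a z) ∂Measure.pi (fun _ => gaussianReal 0 1)
            ∂gaussianReal 0 1 := by
      intro H hH
      rw [← hmp.lintegral_comp hH, lintegral_prod _ (by fun_prop)]
      simp only [MeasurableEquiv.piFinSuccAbove_symm_apply, Fin.insertNthEquiv]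
      simp
    have hcons : Measurable fun p : ℝ × (Fin n → ℝ) => (Fin.cons p.1 p.2 : Fin (n + 1) → ℝ) := by
      refine measurable_pi_lambda _ fun i => ?_
      refine Fin.cases ?_ (fun j => ?_) i
      · simpa using measurable_fst
      · simp only [Fin.cons_succ]
        fun_prop
    rw [split hF, split hG]
    refine lintegral_mul_lintegral_gaussianReal_le_one
      (Measurable.lintegral_prod_right' (hF.comp hcons))
      (Measurable.lintegral_prod_right' (hG.comp hcons)) fun a b => ?_
    have hF' : Measurable fun z : Fin n → ℝ => F (Fin.cons a z) :=
      (hF.comp hcons).comp measurable_prodMk_left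
    have hG' : Measurable fun z : Fin n → ℝ => G (Fin.cons b z) :=
      (hG.comp hcons).comp measurable_prodMk_left
    set c := ENNReal.ofReal (Real.exp ((a - b) ^ 2 / 4))
    have hc0 : c ≠ 0 := by simpa [c] using Real.exp_pos _
    have hc : c ≠ ∞ := ENNReal.ofReal_ne_top
    -- The cost is additive over coordinates: with the first ones frozen, their share is absorbed
    -- into F.
    have := ih (F := fun z => c⁻¹ * F (Fin.cons a z)) (hF'.const_mul _) hG' fun z y => by
      have := h (Fin.cons a z) (Fin.cons b y)
      rw [Fin.sum_univ_succ, add_div, Real.exp_add, ENNReal.ofReal_mul (Real.exp_pos _).le] at this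
      simp only [Fin.cons_zero, Fin.cons_succ] at this
      rw [mul_assoc]
      exact (ENNReal.inv_mul_le_iff hc0 hc).2 this
    rw [lintegral_const_mul _ hF', mul_assoc, ENNReal.inv_mul_le_iff hc0 hc, mul_one] at this
    exact this

/-- Property (τ) of the standard Gaussian measure on a Euclidean space. -/
lemma lintegral_mul_lintegral_stdGaussian_le_one {n : ℕ}
    {F G : EuclideanSpace ℝ (Fin n) → ℝ≥0∞} (hF : Measurable F) (hG : Measurable G)
    (h : ∀ z y, F z * G y ≤ ENNReal.ofReal (Real.exp (‖z - y‖ ^ 2 / 4))) :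
    (∫⁻ z, F z ∂stdGaussian (EuclideanSpace ℝ (Fin n))) *
      ∫⁻ y, G y ∂stdGaussian (EuclideanSpace ℝ (Fin n)) ≤ 1 := by
  rw [← map_pi_eq_stdGaussian, lintegral_map hF (by fun_prop), lintegral_map hG (by fun_prop)]
  refine lintegral_mul_lintegral_pi_gaussianReal_le_one (hF.comp (by fun_prop))
    (hG.comp (by fun_prop)) fun z y => ?_
  refine (h _ _).trans_eq ?_
  simp [EuclideanSpace.real_norm_sq_eq]

/-- A consequence of `1 + t ≤ exp t`. -/
lemma ofReal_one_add_integral_le_lintegral_exp {Ω : Type*} [MeasurableSpace Ω] {μ : Measure Ω}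
    [IsProbabilityMeasure μ] {f : Ω → ℝ} (hf : Integrable f μ) :
    ENNReal.ofReal (1 + ∫ x, f x ∂μ) ≤ ∫⁻ x, ENNReal.ofReal (Real.exp (f x)) ∂μ := by
  have hi : Integrable (fun x => max (1 + f x) 0) μ :=
    ((integrable_const 1).add hf).pos_part
  calc ENNReal.ofReal (1 + ∫ x, f x ∂μ) = ENNReal.ofReal (∫ x, (1 + f x) ∂μ) := by
        rw [integral_add (by fun_prop) hf]
        simp
    _ ≤ ENNReal.ofReal (∫ x, max (1 + f x) 0 ∂μ) :=
        ENNReal.ofReal_le_ofReal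
          (integral_mono (by fun_prop) hi fun x => le_max_left _ _)
    _ = ∫⁻ x, ENNReal.ofReal (max (1 + f x) 0) ∂μ :=
        ofReal_integral_eq_lintegral_ofReal hi (ae_of_all _ fun x => le_max_right _ _)
    _ ≤ _ := by
        gcongr with x
        refine max_le ?_ (Real.exp_pos _).le
        have := Real.add_one_le_exp (f x)
        linarith

/-- An exponential inequality for a function `w` with subgradient `g` under the standard Gaussian
measure. -/
lemma lintegral_exp_sub_sq_subgradient_le {n : ℕ} {w : EuclideanSpace ℝ (Fin n) → ℝ}
    {g : EuclideanSpace ℝ (Fin n) → EuclideanSpace ℝ (Fin n)} (hw : Measurable w)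
    (hg : Measurable g) (hwi : Integrable w (stdGaussian (EuclideanSpace ℝ (Fin n))))
    (h : ∀ z y, w z + ⟪g z, y - z⟫ ≤ w y) (l : ℝ) (hl : 0 ≤ l) :
    ∫⁻ z, ENNReal.ofReal (Real.exp (l * w z - l ^ 2 * ‖g z‖ ^ 2
        - l * ∫ y, w y ∂stdGaussian (EuclideanSpace ℝ (Fin n))))
      ∂stdGaussian (EuclideanSpace ℝ (Fin n)) ≤ 1 := by
  set γ := stdGaussian (EuclideanSpace ℝ (Fin n))
  set m := ∫ y, w y ∂γ
  have htau := lintegral_mul_lintegral_stdGaussian_le_one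
    (F := fun z => ENNReal.ofReal (Real.exp (l * w z - l ^ 2 * ‖g z‖ ^ 2 - l * m)))
    (G := fun y => ENNReal.ofReal (Real.exp (l * m - l * w y)))
    (by fun_prop) (by fun_prop) (fun z y => by
      rw [← ENNReal.ofReal_mul (Real.exp_pos _).le, ← Real.exp_add]
      refine ENNReal.ofReal_le_ofReal (Real.exp_le_exp.2 ?_)
      have h1 := mul_le_mul_of_nonneg_left (h z y) hl
      -- Completing the square: l⟪g z, z − y⟫ − l²‖g z‖² ≤ ‖z − y‖²/4.
      have h2 : 0 ≤ ‖(2 : ℝ)⁻¹ • (y - z) + l • g z‖ ^ 2 := sq_nonneg _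
      rw [norm_add_sq_real, norm_smul, norm_smul, real_inner_smul_left, real_inner_smul_right,
        mul_pow, mul_pow, Real.norm_eq_abs, Real.norm_eq_abs, sq_abs, sq_abs,
        real_inner_comm, norm_sub_rev] at h2
      nlinarith)
  have hG1 : 1 ≤ ∫⁻ y, ENNReal.ofReal (Real.exp (l * m - l * w y)) ∂γ := by
    have h1 : ∫ y, (l * m - l * w y) ∂γ = 0 := by
      rw [integral_sub (by fun_prop) (by fun_prop), integral_const_mul l w]
      simp [m]
    simpa [h1] using ofReal_one_add_integral_le_lintegral_exp
      (show Integrable (fun y => l * m - l * w y) γ by fun_prop)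
  exact (le_mul_of_one_le_right' hG1).trans htau

/-! ### Gaussian density, Cameron–Martin, and the risk -/

section Density

variable {n : ℕ}

/-- The density of the standard Gaussian measure on a Euclidean space. -/
noncomputable def stdGaussianDensity (x : EuclideanSpace ℝ (Fin n)) : ℝ :=
  ((2 * Real.pi) ^ (n / 2 : ℝ))⁻¹ * Real.exp (-(1 / 2) * ‖x‖ ^ 2)

lemma stdGaussianDensity_pos (x : EuclideanSpace ℝ (Fin n)) : 0 < stdGaussianDensity x := by
  unfold stdGaussianDensity
  positivity

lemma continuous_stdGaussianDensity :
    Continuous (stdGaussianDensity : EuclideanSpace ℝ (Fin n) → ℝ) := by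
  unfold stdGaussianDensity
  fun_prop

lemma integrable_stdGaussianDensity :
    Integrable (stdGaussianDensity : EuclideanSpace ℝ (Fin n) → ℝ) := by
  refine Integrable.const_mul ?_ _
  have := GaussianFourier.integrable_cexp_neg_mul_sq_norm_add (V := EuclideanSpace ℝ (Fin n))
    (b := 1 / 2) (by norm_num) 0 0
  refine this.re.congr (ae_of_all _ fun x => ?_)
  simp only [zero_mul, add_zero]
  have : (-(1 / 2) * (‖x‖ : ℂ) ^ 2) = ((-(1 / 2) * ‖x‖ ^ 2 : ℝ) : ℂ) := by push_cast; ring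
  rw [this, ← Complex.ofReal_exp]
  exact Complex.ofReal_re _

/-- The two finite measures have the same characteristic function. -/
lemma stdGaussian_eq_withDensity :
    stdGaussian (EuclideanSpace ℝ (Fin n)) =
      volume.withDensity fun x => ENNReal.ofReal (stdGaussianDensity x) := by
  have : IsFiniteMeasure ((volume : Measure (EuclideanSpace ℝ (Fin n))).withDensity
      fun x => ENNReal.ofReal (stdGaussianDensity x)) :=
    isFiniteMeasure_withDensity_ofReal integrable_stdGaussianDensity.2
  refine Measure.ext_of_charFun ?_
  ext t
  rw [charFun_stdGaussian, charFun_apply, integral_withDensity_eq_integral_toReal_smul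
    (continuous_stdGaussianDensity.measurable.ennreal_ofReal) (by simp)]
  have h := GaussianFourier.integral_cexp_neg_mul_sq_norm_add (V := EuclideanSpace ℝ (Fin n))
    (b := 1 / 2) (by norm_num) Complex.I t
  have hc : (((2 * Real.pi) ^ (n / 2 : ℝ) : ℝ) : ℂ) ≠ 0 := by
    exact_mod_cast (by positivity : ((2 * Real.pi) ^ (n / 2 : ℝ) : ℝ) ≠ 0)
  have hpi : ((Real.pi : ℂ) / (1 / 2)) ^ ((Module.finrank ℝ (EuclideanSpace ℝ (Fin n)) : ℂ) / 2)
      = (((2 * Real.pi) ^ (n / 2 : ℝ) : ℝ) : ℂ) := by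
    rw [Complex.ofReal_cpow (by positivity)]
    simp [mul_comm]
  have e : ∀ x : EuclideanSpace ℝ (Fin n),
      (ENNReal.ofReal (stdGaussianDensity x)).toReal • Complex.exp (⟪x, t⟫ * Complex.I)
      = (((2 * Real.pi) ^ (n / 2 : ℝ) : ℝ) : ℂ)⁻¹ *
        Complex.exp (-(1 / 2) * (‖x‖ : ℂ) ^ 2 + Complex.I * ⟪t, x⟫) := by
    intro x
    rw [ENNReal.toReal_ofReal (stdGaussianDensity_pos x).le, stdGaussianDensity, Complex.exp_add,
      Complex.real_smul, real_inner_comm]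
    push_cast
    ring_nf
  simp_rw [e]
  rw [integral_const_mul, h, hpi, inv_mul_cancel_left₀ hc]
  congr 1
  rw [Complex.I_sq]
  ring

lemma lintegral_stdGaussian {F : EuclideanSpace ℝ (Fin n) → ℝ≥0∞} (hF : Measurable F) :
    ∫⁻ z, F z ∂stdGaussian (EuclideanSpace ℝ (Fin n)) =
      ∫⁻ z, ENNReal.ofReal (stdGaussianDensity z) * F z := by
  rw [stdGaussian_eq_withDensity, lintegral_withDensity_eq_lintegral_mul _
    continuous_stdGaussianDensity.measurable.ennreal_ofReal hF]
  rfl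

/-- The Cameron–Martin formula. -/
lemma lintegral_exp_mul_comp_add_stdGaussian {F : EuclideanSpace ℝ (Fin n) → ℝ≥0∞}
    (hF : Measurable F) (m : EuclideanSpace ℝ (Fin n)) :
    ∫⁻ z, ENNReal.ofReal (Real.exp (-⟪z, m⟫ - ‖m‖ ^ 2 / 2)) * F (z + m)
      ∂stdGaussian (EuclideanSpace ℝ (Fin n)) =
    ∫⁻ z, F z ∂stdGaussian (EuclideanSpace ℝ (Fin n)) := by
  rw [lintegral_stdGaussian hF, lintegral_stdGaussian (by fun_prop),
    ← lintegral_add_right_eq_self (fun z => ENNReal.ofReal (stdGaussianDensity z) * F z) m]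
  refine lintegral_congr fun z => ?_
  rw [← mul_assoc, ← ENNReal.ofReal_mul (stdGaussianDensity_pos z).le]
  congr 2
  rw [stdGaussianDensity, stdGaussianDensity, mul_assoc, ← Real.exp_add, norm_add_sq_real]
  ring_nf

lemma stdGaussian_absolutelyContinuous :
    stdGaussian (EuclideanSpace ℝ (Fin n)) ≪ volume := by
  rw [stdGaussian_eq_withDensity]
  exact withDensity_absolutelyContinuous _ _

lemma absolutelyContinuous_stdGaussian :
    volume ≪ stdGaussian (EuclideanSpace ℝ (Fin n)) := by
  rw [stdGaussian_eq_withDensity]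
  refine withDensity_absolutelyContinuous'
    continuous_stdGaussianDensity.measurable.ennreal_ofReal.aemeasurable (ae_of_all _ fun x => ?_)
  simpa using stdGaussianDensity_pos x

lemma law_eq_map (θ : EuclideanSpace ℝ (Fin n)) :
    law θ = (stdGaussian (EuclideanSpace ℝ (Fin n))).map (fun z => θ + z) := by
  simp [law, multivariateGaussian]

lemma law_absolutelyContinuous (θ : EuclideanSpace ℝ (Fin n)) : law θ ≪ volume := by
  rw [law_eq_map]
  have h := (stdGaussian_absolutelyContinuous (n := n)).map (f := fun z => θ + z) (by fun_prop)
  rwa [(measurePreserving_add_left volume θ).map_eq] at h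

lemma risk_congr {δ P : EuclideanSpace ℝ (Fin n) → EuclideanSpace ℝ (Fin n)}
    (h : δ =ᵐ[volume] P) (θ : EuclideanSpace ℝ (Fin n)) : risk δ θ = risk P θ := by
  refine lintegral_congr_ae ?_
  filter_upwards [(law_absolutelyContinuous θ).ae_le h] with x hx
  rw [hx]

lemma risk_eq_lintegral_stdGaussian
    {P : EuclideanSpace ℝ (Fin n) → EuclideanSpace ℝ (Fin n)} (hP : Measurable P)
    (θ : EuclideanSpace ℝ (Fin n)) :
    risk P θ = ∫⁻ z, ENNReal.ofReal (‖P (θ + z) - θ‖ ^ 2)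
      ∂stdGaussian (EuclideanSpace ℝ (Fin n)) := by
  rw [risk, law_eq_map, lintegral_map (by fun_prop) (by fun_prop)]

end Density

/-! ### Proximal maps and the conjugate function -/

section Prox

variable {E : Type*} [NormedAddCommGroup E] [InnerProductSpace ℝ E] {Θ : Set E} {f : E → ℝ}

/-- The variational inequality satisfied by a minimizer of `½‖x - α‖² + f α`. -/
lemma inner_sub_le_of_isMinOn (hΘ : Convex ℝ Θ) (hf : ConvexOn ℝ Θ f) {x p α : E} (hp : p ∈ Θ)
    (hmin : IsMinOn (fun α => (1 / 2 : ℝ) * ‖x - α‖ ^ 2 + f α) Θ p) (hα : α ∈ Θ) :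
    ⟪x - p, α - p⟫ ≤ f α - f p := by
  have key : ∀ t : ℝ, 0 < t → t ≤ 1 →
      ⟪x - p, α - p⟫ ≤ f α - f p + t / 2 * ‖α - p‖ ^ 2 := by
    intro t ht0 ht1
    have hmem : (1 - t) • p + t • α ∈ Θ := hΘ hp hα (by linarith) ht0.le (by ring)
    have h1 := hf.2 hp hα (by linarith : 0 ≤ 1 - t) ht0.le (by ring)
    have h2 := isMinOn_iff.1 hmin _ hmem
    have h3 : x - ((1 - t) • p + t • α) = (x - p) - t • (α - p) := by module
    simp only [h3, norm_sub_sq_real, real_inner_smul_right, norm_smul, Real.norm_eq_abs, mul_pow,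
      sq_abs, smul_eq_mul] at h1 h2
    refine le_of_mul_le_mul_left ?_ ht0
    rw [norm_sub_sq_real α p]
    nlinarith
  by_contra hcon
  rw [not_le] at hcon
  set K := ‖α - p‖ ^ 2
  have hK : 0 ≤ K := sq_nonneg _
  set c := ⟪x - p, α - p⟫ - (f α - f p)
  have hc : 0 < c := by linarith
  -- Small enough that the error t/2 · K in `key` is at most c/2; this replaces the limit t → 0.
  have ht : 0 < min 1 (c / (K + 1)) := lt_min one_pos (by positivity)
  have h := key _ ht (min_le_left _ _)
  have h1 : min 1 (c / (K + 1)) * K ≤ c := by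
    calc min 1 (c / (K + 1)) * K ≤ c / (K + 1) * (K + 1) := by
          gcongr
          · exact min_le_right _ _
          · linarith
      _ = c := by field_simp
  nlinarith

/-- Adding the two variational inequalities gives ‖p − q‖² ≤ ⟪x − y, p − q⟫; then Cauchy–Schwarz. -/
lemma norm_sub_le_of_isMinOn (hΘ : Convex ℝ Θ) (hf : ConvexOn ℝ Θ f) {x y p q : E} (hp : p ∈ Θ)
    (hq : q ∈ Θ) (hpmin : IsMinOn (fun α => (1 / 2 : ℝ) * ‖x - α‖ ^ 2 + f α) Θ p)
    (hqmin : IsMinOn (fun α => (1 / 2 : ℝ) * ‖y - α‖ ^ 2 + f α) Θ q) :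
    ‖p - q‖ ≤ ‖x - y‖ := by
  have h1 := inner_sub_le_of_isMinOn hΘ hf hp hpmin hq
  have h2 := inner_sub_le_of_isMinOn hΘ hf hq hqmin hp
  have h3 : ⟪x - p, q - p⟫ + ⟪y - q, p - q⟫ = ‖p - q‖ ^ 2 - ⟪x - y, p - q⟫ := by
    rw [← real_inner_self_eq_norm_sq]
    simp only [inner_sub_left, inner_sub_right]
    ring
  have h4 := real_inner_le_norm (x - y) (p - q)
  rcases (norm_nonneg (p - q)).eq_or_lt with h | h
  · rw [← h]
    exact norm_nonneg _
  · refine le_of_mul_le_mul_right ?_ h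
    nlinarith

/-- The convex conjugate of `f + ½‖·‖²` on `Θ`. -/
noncomputable def conj (Θ : Set E) (f : E → ℝ) (x : E) : ℝ :=
  ⨆ α : Θ, (⟪x, (α : E)⟫ - f α - ‖(α : E)‖ ^ 2 / 2)

variable {M : ℝ}

lemma inner_sub_le (hM : ∀ α ∈ Θ, M ≤ f α) (x : E) (α : Θ) :
    ⟪x, (α : E)⟫ - f α - ‖(α : E)‖ ^ 2 / 2 ≤ ‖x‖ ^ 2 / 2 - M := by
  have h1 := hM α α.2
  have h2 : 0 ≤ ‖x - α‖ ^ 2 := sq_nonneg _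
  rw [norm_sub_sq_real] at h2
  linarith

lemma le_conj (hM : ∀ α ∈ Θ, M ≤ f α) (x : E) {α : E} (hα : α ∈ Θ) :
    ⟪x, α⟫ - f α - ‖α‖ ^ 2 / 2 ≤ conj Θ f x :=
  le_ciSup (f := fun α : Θ => ⟪x, (α : E)⟫ - f α - ‖(α : E)‖ ^ 2 / 2)
    ⟨‖x‖ ^ 2 / 2 - M, by rintro _ ⟨α, rfl⟩; exact inner_sub_le hM x α⟩ ⟨α, hα⟩

lemma conj_le (hne : Θ.Nonempty) (hM : ∀ α ∈ Θ, M ≤ f α) (x : E) :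
    conj Θ f x ≤ ‖x‖ ^ 2 / 2 - M :=
  have := hne.to_subtype
  ciSup_le fun α => inner_sub_le hM x α

lemma convexOn_conj (hne : Θ.Nonempty) (hM : ∀ α ∈ Θ, M ≤ f α) :
    ConvexOn ℝ Set.univ (conj Θ f) := by
  have := hne.to_subtype
  refine ⟨convex_univ, fun x _ y _ a b ha hb hab => ciSup_le fun α => ?_⟩
  have h1 := mul_le_mul_of_nonneg_left (le_conj hM x α.2) ha
  have h2 := mul_le_mul_of_nonneg_left (le_conj hM y α.2) hb
  rw [inner_add_left, real_inner_smul_left, real_inner_smul_left, smul_eq_mul, smul_eq_mul]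
  obtain rfl : b = 1 - a := by linarith
  nlinarith

/-- Expanding the square, p attains the supremum defining the conjugate at x. -/
lemma conj_add_inner_le (hM : ∀ α ∈ Θ, M ≤ f α) {x p : E} (hp : p ∈ Θ)
    (hmin : IsMinOn (fun α => (1 / 2 : ℝ) * ‖x - α‖ ^ 2 + f α) Θ p) (y : E) :
    conj Θ f x + ⟪p, y - x⟫ ≤ conj Θ f y := by
  have hne : Nonempty Θ := ⟨p, hp⟩
  have hx : conj Θ f x ≤ ⟪x, p⟫ - f p - ‖p‖ ^ 2 / 2 := by
    refine ciSup_le fun α => ?_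
    have := isMinOn_iff.1 hmin α α.2
    simp only [norm_sub_sq_real] at this
    linarith
  have hy := le_conj hM y hp
  rw [inner_sub_right, real_inner_comm y, real_inner_comm x]
  linarith

end Prox

/-- A penalized least squares estimator agrees almost everywhere with a nonexpansive map into the
constraint set that is a subgradient of a function of at most quadratic growth. -/
lemma IsPenalizedLSE.exists_lipschitz {n : ℕ} {Θ : Set (EuclideanSpace ℝ (Fin n))}
    (hΘc : IsClosed Θ) (hΘ : Convex ℝ Θ) {f : EuclideanSpace ℝ (Fin n) → ℝ} (hf : ConvexOn ℝ Θ f)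
    (hfb : BddBelow (f '' Θ)) {δ : EuclideanSpace ℝ (Fin n) → EuclideanSpace ℝ (Fin n)}
    (hδ : IsPenalizedLSE Θ f δ) :
    ∃ (P : EuclideanSpace ℝ (Fin n) → EuclideanSpace ℝ (Fin n))
      (u : EuclideanSpace ℝ (Fin n) → ℝ) (M : ℝ), LipschitzWith 1 P ∧ (∀ x, P x ∈ Θ) ∧
      Continuous u ∧ (∀ x y, u x + ⟪P x, y - x⟫ ≤ u y) ∧ (∀ x, u x ≤ ‖x‖ ^ 2 / 2 + M) ∧
      δ =ᵐ[volume] P := by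
  obtain ⟨M, hM'⟩ := hfb
  have hM : ∀ α ∈ Θ, M ≤ f α := fun α hα => hM' ⟨α, hα, rfl⟩
  set S : Set (EuclideanSpace ℝ (Fin n)) :=
    {x | δ x ∈ Θ ∧ IsMinOn (fun α => (1 / 2 : ℝ) * ‖x - α‖ ^ 2 + f α) Θ (δ x)}
  have hS : S ∈ ae (volume : Measure (EuclideanSpace ℝ (Fin n))) := hδ
  have hSd : Dense S := Measure.dense_of_ae hδ
  have hlip : LipschitzOnWith 1 δ S := by
    refine LipschitzOnWith.of_dist_le_mul fun x hx y hy => ?_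
    rw [dist_eq_norm, dist_eq_norm, NNReal.coe_one, one_mul]
    exact norm_sub_le_of_isMinOn hΘ hf hx.1 hy.1 hx.2 hy.2
  -- This extension may have a larger Lipschitz constant; only its continuity is used, and constant
  -- 1 is recovered by density of S.
  obtain ⟨P, hPlip, hP⟩ := hlip.extend_finite_dimension
  have hPc : Continuous P := hPlip.continuous
  have hne : Θ.Nonempty := by
    obtain ⟨x, hx⟩ := hSd.nonempty
    exact ⟨_, hx.1⟩
  have huc : Continuous (conj Θ f) := (convexOn_conj hne hM).locallyLipschitz.continuous
  refine ⟨P, conj Θ f, -M, ?_, ?_, huc, ?_,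
    fun x => by simpa [sub_eq_add_neg] using conj_le hne hM x,
    Filter.mem_of_superset hS hP⟩
  · refine LipschitzWith.of_dist_le_mul fun x y => ?_
    rw [NNReal.coe_one, one_mul]
    refine (hSd.prod hSd).induction
      (P := fun q => dist (P q.1) (P q.2) ≤ dist q.1 q.2) ?_ ?_ (x, y)
    · rintro ⟨x, y⟩ ⟨hx, hy⟩
      rw [← hP hx, ← hP hy]
      simpa using hlip.dist_le_mul x hx y hy
    · exact isClosed_le (by fun_prop) (by fun_prop)
  · intro x
    refine hSd.induction (P := fun x => P x ∈ Θ) ?_ (hΘc.preimage hPc) x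
    intro x hx
    rw [← hP hx]
    exact hx.1
  · intro x
    refine hSd.induction (P := fun x => ∀ y, conj Θ f x + ⟪P x, y - x⟫ ≤ conj Θ f y) ?_ ?_ x
    · intro x hx y
      rw [← hP hx]
      exact conj_add_inner_le hM hx.1 hx.2 y
    · simp only [Set.ofPred_forall]
      exact isClosed_iInter fun y => isClosed_le (by fun_prop) (by fun_prop)

/-! ### Risk of a nonexpansive map -/

section Core

variable {n : ℕ} {P : EuclideanSpace ℝ (Fin n) → EuclideanSpace ℝ (Fin n)}
  {u : EuclideanSpace ℝ (Fin n) → ℝ} {M : ℝ} {Θ : Set (EuclideanSpace ℝ (Fin n))}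

local notation "γ" => stdGaussian (EuclideanSpace ℝ (Fin n))

lemma memLp_two_id_stdGaussian : MemLp (fun z => z) 2 γ := IsGaussian.memLp_two_id

lemma integrable_norm_sq_stdGaussian :
    Integrable (fun z : EuclideanSpace ℝ (Fin n) => ‖z‖ ^ 2) γ :=
  memLp_two_id_stdGaussian.integrable_norm_pow two_ne_zero

lemma integrable_inner_stdGaussian (m : EuclideanSpace ℝ (Fin n)) :
    Integrable (fun z : EuclideanSpace ℝ (Fin n) => ⟪z, m⟫) γ :=
  (memLp_two_id_stdGaussian.integrable one_le_two).inner_const m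

lemma integral_inner_stdGaussian (m : EuclideanSpace ℝ (Fin n)) : ∫ z, ⟪z, m⟫ ∂γ = 0 := by
  have := integral_strongDual_stdGaussian (innerSL ℝ m)
  simpa [real_inner_comm] using this

/-- The quadratic risk of `P` at `θ`, as a real number. -/
noncomputable def realRisk (P : EuclideanSpace ℝ (Fin n) → EuclideanSpace ℝ (Fin n))
    (θ : EuclideanSpace ℝ (Fin n)) : ℝ :=
  ∫ z, ‖P (θ + z) - θ‖ ^ 2 ∂γ

lemma memLp_two_lipschitz (hP : LipschitzWith 1 P) (θ α : EuclideanSpace ℝ (Fin n)) :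
    MemLp (fun z => P (θ + z) - α) 2 γ := by
  have hc := hP.continuous
  refine ((memLp_const (P θ - α)).norm.add memLp_two_id_stdGaussian.norm).mono'
    (by fun_prop) (ae_of_all _ fun z => ?_)
  have := hP.norm_sub_le (θ + z) θ
  rw [add_sub_cancel_left, NNReal.coe_one, one_mul] at this
  calc ‖P (θ + z) - α‖ = ‖(P θ - α) + (P (θ + z) - P θ)‖ := by congr 1; abel
    _ ≤ ‖P θ - α‖ + ‖z‖ := (norm_add_le _ _).trans (by gcongr)

lemma integrable_norm_sub_sq (hP : LipschitzWith 1 P) (θ α : EuclideanSpace ℝ (Fin n)) :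
    Integrable (fun z => ‖P (θ + z) - α‖ ^ 2) γ :=
  (memLp_two_lipschitz hP θ α).integrable_norm_pow two_ne_zero

lemma risk_eq_ofReal_realRisk (hP : LipschitzWith 1 P) (θ : EuclideanSpace ℝ (Fin n)) :
    risk P θ = ENNReal.ofReal (realRisk P θ) := by
  rw [risk_eq_lintegral_stdGaussian hP.continuous.measurable, realRisk,
    ofReal_integral_eq_lintegral_ofReal (integrable_norm_sub_sq hP θ θ)
      (ae_of_all _ fun z => sq_nonneg _)]

lemma realRisk_nonneg (θ : EuclideanSpace ℝ (Fin n)) : 0 ≤ realRisk P θ :=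
  integral_nonneg fun _ => sq_nonneg _

lemma norm_sub_le_add_two_mul (hP : LipschitzWith 1 P) (θ ϑ z : EuclideanSpace ℝ (Fin n)) :
    ‖P (ϑ + z) - ϑ‖ ≤ ‖P (θ + z) - θ‖ + 2 * ‖ϑ - θ‖ := by
  have h := hP.norm_sub_le (ϑ + z) (θ + z)
  rw [add_sub_add_right_eq_sub, NNReal.coe_one, one_mul] at h
  calc ‖P (ϑ + z) - ϑ‖ = ‖(P (θ + z) - θ) + (P (ϑ + z) - P (θ + z)) - (ϑ - θ)‖ := by
        congr 1; abel
    _ ≤ ‖P (θ + z) - θ‖ + ‖P (ϑ + z) - P (θ + z)‖ + ‖ϑ - θ‖ :=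
        (norm_sub_le _ _).trans (by gcongr; exact norm_add_le _ _)
    _ ≤ _ := by linarith

lemma norm_sub_sq_le (hP : LipschitzWith 1 P) (θ ϑ z : EuclideanSpace ℝ (Fin n)) :
    ‖P (ϑ + z) - ϑ‖ ^ 2 ≤ 2 * ‖P (θ + z) - θ‖ ^ 2 + 8 * ‖ϑ - θ‖ ^ 2 := by
  refine (pow_le_pow_left₀ (norm_nonneg _) (norm_sub_le_add_two_mul hP θ ϑ z) 2).trans ?_
  nlinarith [sq_nonneg (‖P (θ + z) - θ‖ - 2 * ‖ϑ - θ‖)]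

lemma realRisk_le (hP : LipschitzWith 1 P) (θ ϑ : EuclideanSpace ℝ (Fin n)) :
    realRisk P ϑ ≤ 2 * realRisk P θ + 8 * ‖ϑ - θ‖ ^ 2 := by
  have hi := integrable_norm_sub_sq hP θ θ
  calc realRisk P ϑ ≤ ∫ z, (2 * ‖P (θ + z) - θ‖ ^ 2 + 8 * ‖ϑ - θ‖ ^ 2) ∂γ :=
        integral_mono (integrable_norm_sub_sq hP ϑ ϑ) (by fun_prop) fun z =>
          norm_sub_sq_le hP θ ϑ z
    _ = _ := by
        rw [integral_add (by fun_prop) (by fun_prop), integral_const_mul]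
        simp [realRisk]

lemma continuous_realRisk (hP : LipschitzWith 1 P) : Continuous (realRisk P) := by
  have hc := hP.continuous
  refine continuous_iff_continuousAt.2 fun θ => ?_
  have hi := integrable_norm_sub_sq hP θ θ
  refine continuousAt_of_dominated (bound := fun z => 2 * ‖P (θ + z) - θ‖ ^ 2 + 8)
    (Filter.Eventually.of_forall fun ϑ => by fun_prop) ?_ (by fun_prop)
    (ae_of_all _ fun z => by fun_prop)
  filter_upwards [Metric.ball_mem_nhds θ one_pos] with ϑ hϑ
  refine ae_of_all _ fun z => ?_
  rw [Real.norm_of_nonneg (sq_nonneg _)]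
  have h1 := norm_sub_sq_le hP θ ϑ z
  rw [mem_ball_iff_norm] at hϑ
  have h2 : ‖ϑ - θ‖ ^ 2 ≤ 1 := pow_le_one₀ (norm_nonneg _) hϑ.le
  linarith

/-- A nonexpansive map cannot have small risk at two distant points. -/
lemma exists_pos_le_realRisk_or (hP : LipschitzWith 1 P) :
    ∃ c > 0, ∀ θ₁ θ₂, 1 ≤ ‖θ₁ - θ₂‖ → c ≤ realRisk P θ₁ ∨ c ≤ realRisk P θ₂ := by
  have hc := hP.continuous
  set B := Metric.ball (0 : EuclideanSpace ℝ (Fin n)) 1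
  have hB : 0 < Measure.real γ B := by
    refine ENNReal.toReal_pos (fun h => ?_) (measure_ne_top _ _)
    exact (Metric.measure_ball_pos volume 0 one_pos).ne' (absolutelyContinuous_stdGaussian h)
  set K := Real.exp (3 / 2)
  have hK1 : 1 ≤ K := Real.one_le_exp (by norm_num)
  have hK : 0 < K := Real.exp_pos _
  refine ⟨Measure.real γ B / (8 * K), by positivity, fun θ₁ θ₂ hθ => ?_⟩
  by_contra! hcon
  obtain ⟨h1, h2⟩ := hcon
  set a := θ₁ - θ₂
  have ha : 0 < ‖a‖ := by linarith
  -- Shifting the second noise by this unit vector brings the two observations to distance ‖a‖ − 1,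
  -- so the two errors sum to at least 1.
  set v := ‖a‖⁻¹ • a
  have hv : ‖v‖ = 1 := by
    rw [norm_smul, norm_inv, norm_norm, inv_mul_cancel₀ ha.ne']
  have hav : ‖a - v‖ = ‖a‖ - 1 := by
    have : a - v = (1 - ‖a‖⁻¹) • a := by rw [sub_smul, one_smul]
    rw [this, norm_smul, Real.norm_of_nonneg (sub_nonneg.2 (inv_le_one_of_one_le₀ hθ)), sub_mul,
      inv_mul_cancel₀ ha.ne', one_mul]
  have hsep : ∀ z, 1 ≤ ‖P (θ₁ + z) - θ₁‖ + ‖P (θ₂ + (z + v)) - θ₂‖ := by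
    intro z
    have h := hP.norm_sub_le (θ₁ + z) (θ₂ + (z + v))
    rw [show θ₁ + z - (θ₂ + (z + v)) = a - v by simp only [a]; abel, hav, NNReal.coe_one,
      one_mul] at h
    have : ‖a‖ ≤ ‖P (θ₁ + z) - P (θ₂ + (z + v))‖ + ‖P (θ₂ + (z + v)) - θ₂‖
        + ‖P (θ₁ + z) - θ₁‖ := by
      calc ‖a‖ = ‖(P (θ₁ + z) - P (θ₂ + (z + v))) + (P (θ₂ + (z + v)) - θ₂)
            - (P (θ₁ + z) - θ₁)‖ := by congr 1; simp only [a]; abel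
        _ ≤ _ := (norm_sub_le _ _).trans (by gcongr; exact norm_add_le _ _)
    linarith
  have hcm := lintegral_exp_mul_comp_add_stdGaussian
    (F := fun z => ENNReal.ofReal (‖P (θ₂ + z) - θ₂‖ ^ 2)) (by fun_prop) v
  have hpt : ∀ z, B.indicator 1 z ≤ ENNReal.ofReal (2 * K) *
      (ENNReal.ofReal (‖P (θ₁ + z) - θ₁‖ ^ 2) +
        ENNReal.ofReal (Real.exp (-⟪z, v⟫ - ‖v‖ ^ 2 / 2)) *
          ENNReal.ofReal (‖P (θ₂ + (z + v)) - θ₂‖ ^ 2)) := by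
    intro z
    by_cases hz : z ∈ B
    · rw [Set.indicator_of_mem hz, ← ENNReal.ofReal_mul (Real.exp_pos _).le,
        ← ENNReal.ofReal_add (by positivity) (by positivity),
        ← ENNReal.ofReal_mul (by positivity), Pi.one_apply, ENNReal.one_le_ofReal]
      have hzn : ‖z‖ < 1 := by simpa [B] using hz
      have hin : ⟪z, v⟫ ≤ 1 := (real_inner_le_norm z v).trans (by rw [hv]; linarith)
      have hw : 1 ≤ K * Real.exp (-⟪z, v⟫ - ‖v‖ ^ 2 / 2) := by
        rw [← Real.exp_add]
        refine Real.one_le_exp ?_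
        rw [hv]
        linarith
      have h := hsep z
      set x := ‖P (θ₁ + z) - θ₁‖
      set y := ‖P (θ₂ + (z + v)) - θ₂‖
      have hxy : 1 ≤ 2 * (x ^ 2 + y ^ 2) := by nlinarith [sq_nonneg (x - y)]
      have h3 := mul_le_mul_of_nonneg_right hw (sq_nonneg y)
      have h4 := mul_le_mul_of_nonneg_right hK1 (sq_nonneg x)
      linarith
    · rw [Set.indicator_of_notMem hz]
      exact zero_le
  have hInt := lintegral_mono (μ := γ) hpt
  rw [lintegral_indicator_one Metric.isOpen_ball.measurableSet,
    lintegral_const_mul _ (by fun_prop), lintegral_add_left (by fun_prop), hcm,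
    ← risk_eq_lintegral_stdGaussian hc.measurable, ← risk_eq_lintegral_stdGaussian hc.measurable,
    risk_eq_ofReal_realRisk hP, risk_eq_ofReal_realRisk hP,
    ← ENNReal.ofReal_add (realRisk_nonneg _) (realRisk_nonneg _),
    ← ENNReal.ofReal_mul (by positivity)] at hInt
  have hfin := ENNReal.toReal_mono ENNReal.ofReal_ne_top hInt
  rw [ENNReal.toReal_ofReal (mul_nonneg (by positivity)
    (add_nonneg (realRisk_nonneg _) (realRisk_nonneg _)))] at hfin
  change Measure.real γ B ≤ _ at hfin
  rw [lt_div_iff₀ (by positivity)] at h1 h2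
  nlinarith

/-- If a nonexpansive map has positive risk on a closed set, its risk is bounded away from zero
there. -/
lemma exists_pos_le_realRisk (hP : LipschitzWith 1 P) (hΘ : IsClosed Θ)
    (hpos : ∀ θ ∈ Θ, 0 < realRisk P θ) : ∃ r > 0, ∀ θ ∈ Θ, r ≤ realRisk P θ := by
  obtain ⟨c, hc, hsep⟩ := exists_pos_le_realRisk_or hP
  by_cases h : ∃ θ₀ ∈ Θ, realRisk P θ₀ < c
  -- One point of risk below c forces risk at least c outside its unit ball, leaving a compact set.
  · obtain ⟨θ₀, hθ₀, hlt⟩ := h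
    have hK : IsCompact (Metric.closedBall θ₀ 1 ∩ Θ) :=
      (isCompact_closedBall θ₀ 1).inter_right hΘ
    obtain ⟨θ₁, hθ₁, hmin⟩ := hK.exists_isMinOn ⟨θ₀, by simp, hθ₀⟩
      (continuous_realRisk hP).continuousOn
    refine ⟨min c (realRisk P θ₁), lt_min hc (hpos θ₁ hθ₁.2), fun θ hθ => ?_⟩
    by_cases hd : θ ∈ Metric.closedBall θ₀ 1
    · exact (min_le_right _ _).trans (isMinOn_iff.1 hmin θ ⟨hd, hθ⟩)
    · refine (min_le_left _ _).trans ?_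
      rw [mem_closedBall_iff_norm, not_le] at hd
      exact (hsep θ θ₀ hd.le).resolve_right (not_le.2 hlt)
  · push Not at h
    exact ⟨c, hc, h⟩

/-! ### Gaussian averages and the centre of the prior -/

/-- The Gaussian average of `u` around `x`. -/
noncomputable def gaussianAverage (u : EuclideanSpace ℝ (Fin n) → ℝ)
    (x : EuclideanSpace ℝ (Fin n)) : ℝ :=
  ∫ z, u (x + z) ∂γ

/-- The function lies between an affine minorant and a quadratic majorant. -/
lemma integrable_comp_add (hu : Continuous u) (hsub : ∀ x y, u x + ⟪P x, y - x⟫ ≤ u y)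
    (hub : ∀ x, u x ≤ ‖x‖ ^ 2 / 2 + M) (x : EuclideanSpace ℝ (Fin n)) :
    Integrable (fun z => u (x + z)) γ := by
  have h2 := integrable_norm_sq_stdGaussian (n := n)
  refine Integrable.mono' (g := fun z => (|u x| + ‖P x‖ ^ 2 + ‖x‖ ^ 2 + |M|) + ‖z‖ ^ 2)
    (by fun_prop) (by fun_prop) (ae_of_all _ fun z => ?_)
  have h1 := hsub x (x + z)
  rw [add_sub_cancel_left] at h1
  have h3 := abs_le.1 (abs_real_inner_le_norm (P x) z)
  have h4 := hub (x + z)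
  have h5 := pow_le_pow_left₀ (norm_nonneg _) (norm_add_le x z) 2
  have h6 := neg_abs_le (u x)
  have h7 := le_abs_self M
  have h8 := abs_nonneg (u x)
  have h9 := abs_nonneg M
  rw [Real.norm_eq_abs, abs_le]
  constructor
  · nlinarith [sq_nonneg (‖P x‖ - ‖z‖), sq_nonneg (‖P x‖), sq_nonneg (‖x‖), sq_nonneg ‖z‖]
  · nlinarith [sq_nonneg (‖x‖ - ‖z‖), sq_nonneg (‖P x‖)]

lemma measurable_gaussianAverage (hu : Continuous u) : Measurable (gaussianAverage u) := by
  have : StronglyMeasurable (Function.uncurry fun x z : EuclideanSpace ℝ (Fin n) => u (x + z)) :=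
    Continuous.stronglyMeasurable (by unfold Function.uncurry; fun_prop)
  exact this.integral_prod_right.measurable

lemma gaussianAverage_sub_le (hu : Continuous u) (hsub : ∀ x y, u x + ⟪P x, y - x⟫ ≤ u y)
    (hub : ∀ x, u x ≤ ‖x‖ ^ 2 / 2 + M) (x : EuclideanSpace ℝ (Fin n)) :
    gaussianAverage u x - ‖x‖ ^ 2 / 2 ≤ (∫ z, ‖z‖ ^ 2 ∂γ) / 2 + M := by
  have h2 := integrable_norm_sq_stdGaussian (n := n)
  have h1 := integrable_inner_stdGaussian x
  have : gaussianAverage u x ≤ ∫ z, (‖x‖ ^ 2 / 2 + M + ⟪z, x⟫ + ‖z‖ ^ 2 / 2) ∂γ := by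
    refine integral_mono (integrable_comp_add hu hsub hub x) (by fun_prop) fun z => ?_
    refine (hub _).trans_eq ?_
    rw [norm_add_sq_real, real_inner_comm]
    ring
  rw [integral_add (by fun_prop) (by fun_prop), integral_add (by fun_prop) h1,
    integral_inner_stdGaussian, integral_div] at this
  simp only [integral_const, probReal_univ, one_smul] at this
  linarith

/-- The function `x ↦ E u(x + Z) - ‖x‖²/2` is nearly maximized, over the whole space, at a point
of the range of `P`. -/
lemma exists_nearly_maximal (hP : LipschitzWith 1 P) (hPΘ : ∀ x, P x ∈ Θ) (hΘc : IsClosed Θ)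
    (hΘ : Convex ℝ Θ) (hu : Continuous u) (hsub : ∀ x y, u x + ⟪P x, y - x⟫ ≤ u y)
    (hub : ∀ x, u x ≤ ‖x‖ ^ 2 / 2 + M) {η : ℝ} (hη : 0 < η) :
    ∃ θ ∈ Θ, ∀ x, gaussianAverage u x - ‖x‖ ^ 2 / 2
      ≤ gaussianAverage u θ - ‖θ‖ ^ 2 / 2 + η := by
  set V := fun x => gaussianAverage u x - ‖x‖ ^ 2 / 2
  have hV : BddAbove (Set.range V) :=
    ⟨_, by rintro _ ⟨x, rfl⟩; exact gaussianAverage_sub_le hu hsub hub x⟩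
  obtain ⟨x₀, hx₀⟩ := exists_lt_of_lt_ciSup (show (⨆ x, V x) - η < ⨆ x, V x by linarith)
  have hPi : Integrable (fun z => P (x₀ + z)) γ := by
    simpa using (memLp_two_lipschitz hP x₀ 0).integrable one_le_two
  -- A subgradient of the average at x₀: moving there raises V by at least ‖θ − x₀‖²/2, and lands in
  -- Θ.
  set θ := ∫ z, P (x₀ + z) ∂γ
  refine ⟨θ, hΘ.integral_mem hΘc (ae_of_all _ fun z => hPΘ _) hPi, fun x => ?_⟩
  have hstep : V x₀ ≤ V θ := by
    have h1 : gaussianAverage u x₀ + ⟪θ, θ - x₀⟫ ≤ gaussianAverage u θ := by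
      have hi : Integrable (fun z => ⟪P (x₀ + z), θ - x₀⟫) γ := hPi.inner_const _
      calc gaussianAverage u x₀ + ⟪θ, θ - x₀⟫
          = ∫ z, (u (x₀ + z) + ⟪P (x₀ + z), θ - x₀⟫) ∂γ := by
            rw [integral_add (integrable_comp_add hu hsub hub x₀) hi]
            congr 1
            simp_rw [real_inner_comm (θ - x₀)]
            exact (integral_inner hPi (θ - x₀)).symm
        _ ≤ _ := by
            refine integral_mono ((integrable_comp_add hu hsub hub x₀).add hi)
              (integrable_comp_add hu hsub hub θ) fun z => ?_
            have := hsub (x₀ + z) (θ + z)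
            rwa [add_sub_add_right_eq_sub] at this
    have h2 : 0 ≤ ‖θ - x₀‖ ^ 2 := sq_nonneg _
    rw [norm_sub_sq_real] at h2
    rw [inner_sub_right, real_inner_self_eq_norm_sq] at h1
    simp only [V]
    linarith
  have := le_ciSup hV x
  simp only [V] at *
  linarith

/-! ### The Bayes risk lower bound -/

/-- The exponential bound behind the Bayes risk lower bound: under the shifted product measure,
the likelihood ratio is compensated. -/
lemma lintegral_prod_exp_le_one (hP : LipschitzWith 1 P) (hu : Continuous u)
    (hsub : ∀ x y, u x + ⟪P x, y - x⟫ ≤ u y) (hub : ∀ x, u x ≤ ‖x‖ ^ 2 / 2 + M)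
    (θ : EuclideanSpace ℝ (Fin n)) {m D : EuclideanSpace ℝ (Fin n) → EuclideanSpace ℝ (Fin n)}
    (hm : Measurable m) (hD : Measurable D) {l : ℝ} (hl : 0 ≤ l) :
    ∫⁻ ω, ENNReal.ofReal (Real.exp (-⟪ω.2, m ω.1⟫ - ‖m ω.1‖ ^ 2 / 2)) *
      ENNReal.ofReal (Real.exp (l * (u (D (ω.2 + m ω.1) + ω.1) - ⟪ω.1, θ⟫)
        - l ^ 2 * ‖P (D (ω.2 + m ω.1) + ω.1) - θ‖ ^ 2
        - l * gaussianAverage u (D (ω.2 + m ω.1)))) ∂(Measure.prod γ γ) ≤ 1 := by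
  have hPm := hP.continuous.measurable
  have hum := hu.measurable
  have hA := measurable_gaussianAverage hu
  rw [lintegral_prod _ (by fun_prop)]
  have hcm : ∀ z, ∫⁻ z', ENNReal.ofReal (Real.exp (-⟪z', m z⟫ - ‖m z‖ ^ 2 / 2)) *
      ENNReal.ofReal (Real.exp (l * (u (D (z' + m z) + z) - ⟪z, θ⟫)
        - l ^ 2 * ‖P (D (z' + m z) + z) - θ‖ ^ 2 - l * gaussianAverage u (D (z' + m z)))) ∂γ
      = ∫⁻ x, ENNReal.ofReal (Real.exp (l * (u (D x + z) - ⟪z, θ⟫)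
        - l ^ 2 * ‖P (D x + z) - θ‖ ^ 2 - l * gaussianAverage u (D x))) ∂γ := by
    intro z
    exact lintegral_exp_mul_comp_add_stdGaussian
      (F := fun x => ENNReal.ofReal (Real.exp (l * (u (D x + z) - ⟪z, θ⟫)
        - l ^ 2 * ‖P (D x + z) - θ‖ ^ 2 - l * gaussianAverage u (D x)))) (by fun_prop) (m z)
  simp only [hcm]
  rw [lintegral_lintegral_swap (by unfold Function.uncurry; fun_prop)]
  calc _ ≤ ∫⁻ _, 1 ∂γ := lintegral_mono fun x => ?_
    _ = 1 := by simp
  have hui := integrable_comp_add hu hsub hub (D x)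
  -- For a fixed observation D x is constant. The linear term recentres the subgradient at θ without
  -- changing the mean.
  have h := lintegral_exp_sub_sq_subgradient_le (w := fun z => u (D x + z) - ⟪z, θ⟫)
    (g := fun z => P (D x + z) - θ) (by fun_prop) (by fun_prop)
    (hui.sub (integrable_inner_stdGaussian θ)) (fun z y => by
      have := hsub (D x + z) (D x + y)
      rw [add_sub_add_left_eq_sub] at this
      rw [inner_sub_left, inner_sub_right θ, real_inner_comm y, real_inner_comm z]
      linarith) l hl
  rw [integral_sub hui (integrable_inner_stdGaussian θ), integral_inner_stdGaussian,
    sub_zero] at h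
  exact h

/-- The Bayes risk lower bound. The prior is the law of `θ + s (P(θ + Z) - θ)` with `Z` standard
Gaussian, and `D` is an arbitrary estimator of `P(θ + Z)`. -/
lemma bayes_lower_bound (hP : LipschitzWith 1 P) (hu : Continuous u)
    (hsub : ∀ x y, u x + ⟪P x, y - x⟫ ≤ u y) (hub : ∀ x, u x ≤ ‖x‖ ^ 2 / 2 + M)
    {θ : EuclideanSpace ℝ (Fin n)} {η : ℝ}
    (hθ : ∀ x, gaussianAverage u x - ‖x‖ ^ 2 / 2 ≤ gaussianAverage u θ - ‖θ‖ ^ 2 / 2 + η)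
    {D : EuclideanSpace ℝ (Fin n) → EuclideanSpace ℝ (Fin n)} (hD : Measurable D) (s : ℝ)
    {l : ℝ} (hl : 0 ≤ l)
    (hInt : Integrable (fun ω : EuclideanSpace ℝ (Fin n) × EuclideanSpace ℝ (Fin n) =>
      ‖D (ω.2 + s • (P (θ + ω.1) - θ)) - P (θ + ω.1)‖ ^ 2) (Measure.prod γ γ)) :
    l * (realRisk P θ / 2
        - (∫ ω, ‖D (ω.2 + s • (P (θ + ω.1) - θ)) - P (θ + ω.1)‖ ^ 2 ∂(Measure.prod γ γ)) / 2 - η)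
      ≤ s ^ 2 * realRisk P θ / 2 + l ^ 2 * (8 * realRisk P θ
        + 2 * ∫ ω, ‖D (ω.2 + s • (P (θ + ω.1) - θ)) - P (θ + ω.1)‖ ^ 2 ∂(Measure.prod γ γ)) := by
  have hPc := hP.continuous
  set m : EuclideanSpace ℝ (Fin n) → EuclideanSpace ℝ (Fin n) :=
    fun z => s • (P (θ + z) - θ) with hmdef
  have hm : Measurable m := by fun_prop
  set err : EuclideanSpace ℝ (Fin n) × EuclideanSpace ℝ (Fin n) → ℝ :=
    fun ω => ‖D (ω.2 + m ω.1) - P (θ + ω.1)‖ ^ 2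
  set h : EuclideanSpace ℝ (Fin n) → ℝ := fun z =>
    l * (u (θ + z) - gaussianAverage u θ + ‖P (θ + z) - θ‖ ^ 2 / 2 - ⟪z, θ⟫ - η)
      - l ^ 2 * (8 * ‖P (θ + z) - θ‖ ^ 2) - s ^ 2 * ‖P (θ + z) - θ‖ ^ 2 / 2 with hh
  have hui := integrable_comp_add hu hsub hub θ
  have hin := integrable_inner_stdGaussian θ
  have hPi := integrable_norm_sub_sq hP θ θ
  have aux : ∀ {a b c : EuclideanSpace ℝ (Fin n) → ℝ}, Integrable a γ → Integrable b γ →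
      Integrable c γ → ∀ k : ℝ,
      Integrable (fun z => l * (a z - k + b z / 2 - c z - η) - l ^ 2 * (8 * b z)
        - s ^ 2 * b z / 2) γ ∧
      ∫ z, (l * (a z - k + b z / 2 - c z - η) - l ^ 2 * (8 * b z) - s ^ 2 * b z / 2) ∂γ
        = l * ((∫ z, a z ∂γ) - k + (∫ z, b z ∂γ) / 2 - (∫ z, c z ∂γ) - η)
          - l ^ 2 * (8 * ∫ z, b z ∂γ) - s ^ 2 * (∫ z, b z ∂γ) / 2 := by
    intro a b c ha hb hc k
    refine ⟨by fun_prop, ?_⟩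
    rw [integral_sub (by fun_prop) (by fun_prop), integral_sub (by fun_prop) (by fun_prop),
      integral_const_mul, integral_const_mul, integral_const_mul, integral_div,
      integral_const_mul, integral_sub (by fun_prop) (by fun_prop),
      integral_sub (by fun_prop) (by fun_prop), integral_add (by fun_prop) (by fun_prop),
      integral_sub (by fun_prop) (by fun_prop), integral_div]
    simp
  obtain ⟨hhi, hhint⟩ := aux hui hPi hin (gaussianAverage u θ)
  replace hhint : ∫ z, h z ∂γ = l * (realRisk P θ / 2 - η) - l ^ 2 * (8 * realRisk P θ)
      - s ^ 2 * realRisk P θ / 2 := by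
    refine hhint.trans ?_
    rw [integral_inner_stdGaussian]
    simp only [realRisk, gaussianAverage]
    ring
  have hcross : Integrable (fun ω : EuclideanSpace ℝ (Fin n) × EuclideanSpace ℝ (Fin n) =>
      ⟪ω.2, m ω.1⟫) (Measure.prod γ γ) := by
    have h1 : Integrable (fun ω : EuclideanSpace ℝ (Fin n) × EuclideanSpace ℝ (Fin n) =>
      ‖ω.2‖ ^ 2) (Measure.prod γ γ) := (integrable_norm_sq_stdGaussian (n := n)).comp_snd γ
    have h2 : Integrable (fun ω : EuclideanSpace ℝ (Fin n) × EuclideanSpace ℝ (Fin n) =>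
      s ^ 2 * ‖P (θ + ω.1) - θ‖ ^ 2) (Measure.prod γ γ) := (hPi.comp_fst γ).const_mul _
    refine (h1.add h2).mono' (by fun_prop) (ae_of_all _ fun ω => ?_)
    have h3 := abs_real_inner_le_norm ω.2 (m ω.1)
    have h4 : ‖m ω.1‖ ^ 2 = s ^ 2 * ‖P (θ + ω.1) - θ‖ ^ 2 := by
      rw [hmdef, norm_smul, mul_pow, Real.norm_eq_abs, sq_abs]
    rw [Real.norm_eq_abs, Pi.add_apply, ← h4]
    nlinarith [sq_nonneg (‖ω.2‖ - ‖m ω.1‖), sq_nonneg ‖ω.2‖, sq_nonneg ‖m ω.1‖]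
  have hcross0 : ∫ ω, ⟪ω.2, m ω.1⟫ ∂(Measure.prod γ γ) = 0 := by
    rw [integral_prod _ hcross]
    simp [integral_inner_stdGaussian]
  have hh1 : Integrable (fun ω : EuclideanSpace ℝ (Fin n) × EuclideanSpace ℝ (Fin n) => h ω.1)
      (Measure.prod γ γ) := hhi.comp_fst γ
  have herr : Integrable (fun ω => (l / 2 + 2 * l ^ 2) * err ω) (Measure.prod γ γ) := hInt.const_mul _
  have hbound : ∫⁻ ω, ENNReal.ofReal
      (Real.exp (h ω.1 - (l / 2 + 2 * l ^ 2) * err ω - ⟪ω.2, m ω.1⟫)) ∂(Measure.prod γ γ) ≤ 1 := by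
    refine le_trans (lintegral_mono fun ω => ?_)
      (lintegral_prod_exp_le_one hP hu hsub hub θ hm hD hl)
    rw [← ENNReal.ofReal_mul (Real.exp_pos _).le, ← Real.exp_add]
    refine ENNReal.ofReal_le_ofReal (Real.exp_le_exp.2 ?_)
    obtain ⟨z, z'⟩ := ω
    simp only [err, h]
    set d := D (z' + m z)
    set p := P (θ + z)
    have hmn : ‖m z‖ ^ 2 = s ^ 2 * ‖p - θ‖ ^ 2 := by
      rw [hmdef, norm_smul, mul_pow, Real.norm_eq_abs, sq_abs]
    have h1 : u (θ + z) + ⟪p, d - θ⟫ ≤ u (d + z) := by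
      have := hsub (θ + z) (d + z)
      rwa [add_sub_add_right_eq_sub] at this
    have h2 := hθ d
    have h3 : ‖p - θ‖ ^ 2 / 2 - ‖d - p‖ ^ 2 / 2 = ⟪p, d - θ⟫ + ‖θ‖ ^ 2 / 2 - ‖d‖ ^ 2 / 2 := by
      rw [norm_sub_sq_real, norm_sub_sq_real, inner_sub_right, real_inner_comm d p]
      ring
    have h4 : ‖P (d + z) - θ‖ ^ 2 ≤ 8 * ‖p - θ‖ ^ 2 + 2 * ‖d - p‖ ^ 2 := by
      have h5 := hP.norm_sub_le (d + z) (θ + z)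
      rw [add_sub_add_right_eq_sub, NNReal.coe_one, one_mul] at h5
      have h6 : ‖P (d + z) - θ‖ ≤ ‖P (d + z) - p‖ + ‖p - θ‖ :=
        norm_sub_le_norm_sub_add_norm_sub _ _ _
      have h7 : ‖d - θ‖ ≤ ‖d - p‖ + ‖p - θ‖ := norm_sub_le_norm_sub_add_norm_sub _ _ _
      have h8 : ‖P (d + z) - θ‖ ≤ ‖d - p‖ + 2 * ‖p - θ‖ := by linarith
      refine (pow_le_pow_left₀ (norm_nonneg _) h8 2).trans ?_
      nlinarith [sq_nonneg (‖d - p‖ - 2 * ‖p - θ‖)]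
    have h9 : u (θ + z) - gaussianAverage u θ + ‖p - θ‖ ^ 2 / 2 - ‖d - p‖ ^ 2 / 2 - η
        ≤ u (d + z) - gaussianAverage u d := by linarith
    have h10 := mul_le_mul_of_nonneg_left h9 hl
    have h11 := mul_le_mul_of_nonneg_left h4 (sq_nonneg l)
    rw [hmn]
    linarith
  have hdiff : Integrable (fun ω => h ω.1 - (l / 2 + 2 * l ^ 2) * err ω) (Measure.prod γ γ) :=
    hh1.sub herr
  -- An exponential moment at most 1 forces the mean exponent to be at most 0.
  have hle := (ofReal_one_add_integral_le_lintegral_exp (hdiff.sub hcross)).trans hbound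
  rw [ENNReal.ofReal_le_one] at hle
  have hval : ∫ ω, (h ω.1 - (l / 2 + 2 * l ^ 2) * err ω - ⟪ω.2, m ω.1⟫) ∂(Measure.prod γ γ)
      = ∫ z, h z ∂γ - (l / 2 + 2 * l ^ 2) * ∫ ω, err ω ∂(Measure.prod γ γ) := by
    rw [integral_sub hdiff hcross, integral_sub hh1 herr, hcross0,
      integral_const_mul, sub_zero, integral_fun_fst]
    simp
  simp only [Pi.sub_apply] at hle
  rw [hval, hhint] at hle
  change l * (realRisk P θ / 2 - (∫ ω, err ω ∂(Measure.prod γ γ)) / 2 - η) ≤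
    s ^ 2 * realRisk P θ / 2 + l ^ 2 * (8 * realRisk P θ + 2 * ∫ ω, err ω ∂(Measure.prod γ γ))
  linarith

/-! ### The contradiction -/

/-- A nonexpansive map into a closed convex set that is a subgradient of a function of at most
quadratic growth is approximately admissible. -/
theorem isCAdmissible_of_lipschitz (hP : LipschitzWith 1 P) (hPΘ : ∀ x, P x ∈ Θ)
    (hΘc : IsClosed Θ) (hΘ : Convex ℝ Θ) (hu : Continuous u)
    (hsub : ∀ x y, u x + ⟪P x, y - x⟫ ≤ u y) (hub : ∀ x, u x ≤ ‖x‖ ^ 2 / 2 + M) :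
    IsCAdmissible (1 / 2000) Θ P := by
  intro δ' hδ'
  have hPc := hP.continuous
  have hPm := hPc.measurable
  by_contra! hcon
  have hpos : ∀ θ ∈ Θ, 0 < realRisk P θ := fun θ hθ => by
    refine (realRisk_nonneg θ).lt_of_ne' fun h0 => ?_
    have := hcon θ hθ
    rw [risk_eq_ofReal_realRisk hP, h0] at this
    simp at this
  -- The tolerance η must be fixed before θ, yet be small against the risk at θ; hence a uniform
  -- lower bound.
  obtain ⟨r, hr, hrle⟩ := exists_pos_le_realRisk hP hΘc hpos
  obtain ⟨θ, hθ, hmax⟩ := exists_nearly_maximal hP hPΘ hΘc hΘ hu hsub hub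
    (show 0 < r / 100 by positivity)
  set R := realRisk P θ
  have hRr : r ≤ R := hrle θ hθ
  have hPi := integrable_norm_sub_sq hP θ θ
  -- Inverting p ↦ θ + (p − θ)/16 multiplies squared errors by 256.
  set D : EuclideanSpace ℝ (Fin n) → EuclideanSpace ℝ (Fin n) :=
    fun x => θ + (16 : ℝ) • (δ' (θ + x) - θ)
  have hD : Measurable D := by fun_prop
  have hmem : ∀ z, θ + (1 / 16 : ℝ) • (P (θ + z) - θ) ∈ Θ := fun z =>
    hΘ.add_smul_sub_mem hθ (hPΘ _) ⟨by norm_num, by norm_num⟩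
  have hdist : ∀ z z', ‖D (z' + (1 / 16 : ℝ) • (P (θ + z) - θ)) - P (θ + z)‖ ^ 2
      = 256 * ‖δ' (θ + (1 / 16 : ℝ) • (P (θ + z) - θ) + z')
        - (θ + (1 / 16 : ℝ) • (P (θ + z) - θ))‖ ^ 2 := by
    intro z z'
    have e1 : θ + (z' + (1 / 16 : ℝ) • (P (θ + z) - θ))
        = θ + (1 / 16 : ℝ) • (P (θ + z) - θ) + z' := by abel
    simp only [D, e1]
    rw [show ∀ a : EuclideanSpace ℝ (Fin n), θ + (16 : ℝ) • (a - θ) - P (θ + z)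
      = (16 : ℝ) • (a - (θ + (1 / 16 : ℝ) • (P (θ + z) - θ))) by intro a; module,
      norm_smul, mul_pow]
    norm_num
  have hrisk : ∫⁻ ω, ENNReal.ofReal
      (‖D (ω.2 + (1 / 16 : ℝ) • (P (θ + ω.1) - θ)) - P (θ + ω.1)‖ ^ 2) ∂(Measure.prod γ γ)
      ≤ ENNReal.ofReal (3 / 10 * R) := by
    rw [lintegral_prod _ (by fun_prop)]
    calc _ ≤ ∫⁻ z, ENNReal.ofReal
          (256 * (1 / 2000) * (2 * R + 8 * ((1 / 16) ^ 2 * ‖P (θ + z) - θ‖ ^ 2))) ∂γ := by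
          refine lintegral_mono fun z => ?_
          have h1 := (hcon _ (hmem z)).le
          rw [risk_eq_ofReal_realRisk hP, risk_eq_lintegral_stdGaussian hδ'] at h1
          simp only [hdist]
          simp_rw [ENNReal.ofReal_mul (show (0 : ℝ) ≤ 256 by norm_num)]
          rw [lintegral_const_mul _ (by fun_prop), mul_assoc (256 : ℝ),
            ENNReal.ofReal_mul (by norm_num)]
          gcongr
          refine h1.trans ?_
          rw [← ENNReal.ofReal_mul (by norm_num)]
          refine ENNReal.ofReal_le_ofReal ?_
          gcongr
          refine (realRisk_le hP θ _).trans_eq ?_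
          rw [add_sub_cancel_left, norm_smul, mul_pow]
          norm_num
          rfl
      _ = ENNReal.ofReal (∫ z,
          256 * (1 / 2000) * (2 * R + 8 * ((1 / 16) ^ 2 * ‖P (θ + z) - θ‖ ^ 2)) ∂γ) := by
          refine (ofReal_integral_eq_lintegral_ofReal (by fun_prop) (ae_of_all _ fun z => ?_)).symm
          have : 0 ≤ R := realRisk_nonneg θ
          positivity
      _ ≤ _ := by
          refine ENNReal.ofReal_le_ofReal ?_
          rw [integral_const_mul, integral_add (by fun_prop) (by fun_prop), integral_const_mul,
            integral_const_mul, integral_const_mul]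
          simp only [integral_const, probReal_univ, one_smul]
          -- The left side is 0.26 R.
          change 256 * (1 / 2000) * (2 * R + 8 * ((1 / 16) ^ 2 * R)) ≤ 3 / 10 * R
          linarith
  have hnn : 0 ≤ᵐ[Measure.prod γ γ] fun ω : EuclideanSpace ℝ (Fin n) × EuclideanSpace ℝ (Fin n) =>
      ‖D (ω.2 + (1 / 16 : ℝ) • (P (θ + ω.1) - θ)) - P (θ + ω.1)‖ ^ 2 :=
    ae_of_all _ fun ω => sq_nonneg _
  have hInt : Integrable (fun ω : EuclideanSpace ℝ (Fin n) × EuclideanSpace ℝ (Fin n) =>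
      ‖D (ω.2 + (1 / 16 : ℝ) • (P (θ + ω.1) - θ)) - P (θ + ω.1)‖ ^ 2) (Measure.prod γ γ) :=
    (lintegral_ofReal_ne_top_iff_integrable (by fun_prop) hnn).1
      (ne_top_of_le_ne_top ENNReal.ofReal_ne_top hrisk)
  have hlow := bayes_lower_bound hP hu hsub hub hmax hD (1 / 16)
    (show (0 : ℝ) ≤ 1 / 64 by norm_num) hInt
  rw [← ofReal_integral_eq_lintegral_ofReal hInt hnn,
    ENNReal.ofReal_le_ofReal_iff (by linarith)] at hrisk
  -- With s = 1/16, l = 1/64 and η ≤ R/100, the lower bound would give 0.34 R/64 ≤ R/512 + 8.6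
  -- R/4096, impossible for R > 0.
  linarith

end Core

end GaussianSequence

theorem theorem2 :
    ∃ C : ℝ, 0 < C ∧ C ≤ 1 ∧ (6.05e-6 : ℝ) ≤ C ∧
      ∀ n : ℕ, 1 ≤ n →
      ∀ Θ : Set (EuclideanSpace ℝ (Fin n)), IsClosed Θ → Convex ℝ Θ →
      ∀ f : EuclideanSpace ℝ (Fin n) → ℝ, ConvexOn ℝ Θ f → BddBelow (f '' Θ) →
      ∀ δ : EuclideanSpace ℝ (Fin n) → EuclideanSpace ℝ (Fin n),
        GaussianSequence.IsPenalizedLSE Θ f δ →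
        GaussianSequence.IsCAdmissible C Θ δ := by
  refine ⟨1 / 2000, by norm_num, by norm_num, by norm_num, ?_⟩
  intro n _ Θ hΘc hΘ f hf hfb δ hδ δ' hδ'
  obtain ⟨P, u, M, hP, hPΘ, hu, hsub, hub, hδP⟩ := hδ.exists_lipschitz hΘc hΘ hf hfb
  obtain ⟨θ, hθ, h⟩ :=
    GaussianSequence.isCAdmissible_of_lipschitz hP hPΘ hΘc hΘ hu hsub hub δ' hδ'
  exact ⟨θ, hθ, by rwa [GaussianSequence.risk_congr hδP]⟩
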